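/- Let $K\ge 1$ and let $N_0,N_1,\dots,N_K$ be positive integers with $N_0=\min_{0\le k\le K}N_k$. Let $Q_1,\dots,Q_K$ be independent random complex matrices, $Q_k$ of size $N_k\times N_{k-1}$, each having independent and identically distributed standard complex Gaussian entries $\mathcal{CN}(0,1)$ (that is, with density $\pi^{-1}e^{-|z|^2}$ on $\mathbb{C}$), and let $H=Q_KQ_{K-1}\cdots Q_1$, a random $N_K\times N_0$ matrix (the Rayleigh product channel). Let $\hat Q_1,\dots,\hat Q_K$ be independent random complex matrices, $\hat Q_k$ of size $N_k\times N_0$, each having independent and identically distributed $\mathcal{CN}(0,1)$ entries. Then the determinants $\det(H^\dagger H)$ and $\det(\hat Q_k^\dagger\hat Q_k)$, $1\le k\le K$, are almost surely positive, their logarithms are integrable, and $$\mathbb{E}\big[\ln\det(H^\dagger H)\big]=\sum_{k=1}^{K}\mathbb{E}\big[\ln\det(\hat Q_k^\dagger\hat Q_k)\big],$$ where $A^\dagger$ denotes the conjugate transpose of $A$. -/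

import Mathlib

open MeasureTheory ProbabilityTheory
open scoped Matrix

/-- Matrices carry the product (entrywise) σ-algebra. -/
instance matrixMeasurableSpace {m n α : Type*} [MeasurableSpace α] :
    MeasurableSpace (Matrix m n α) :=
  (MeasurableSpace.pi : MeasurableSpace (m → n → α))

/-- The standard circularly symmetric complex Gaussian law `CN(0, 1)` (zero mean, `E|z|² = 1`):
real and imaginary part are independent real Gaussians with mean `0` and variance `1/2`.
Its density with respect to Lebesgue measure on `ℂ` is `exp (-|z|²) / π`. -/
noncomputable def stdComplexGaussian : Measure ℂ :=
  ((gaussianReal 0 (1 / 2)).prod (gaussianReal 0 (1 / 2))).map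
    Complex.measurableEquivRealProd.symm

/-- `Q` is a random `m × n` Rayleigh MIMO channel on `(Ω, μ)`: a random matrix whose entries are
independent and identically distributed `CN(0, 1)` random variables. -/
def IsRayleighMIMO {Ω : Type*} [MeasurableSpace Ω] {m n : ℕ}
    (Q : Ω → Matrix (Fin m) (Fin n) ℂ) (μ : Measure Ω) : Prop :=
  (∀ i j, HasLaw (fun ω => Q ω i j) stdComplexGaussian μ) ∧
    iIndepFun (fun (p : Fin m × Fin n) ω => Q ω p.1 p.2) μ

/-- The ordered matrix product `Q_K * ⋯ * Q_2 * Q_1`, where `Q_{k+1}` (the matrix `Q k`, for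
`k = 0, …, K - 1`) has size `N (k + 1) × N k`. -/
def channelProduct {K : ℕ} (N : Fin (K + 1) → ℕ)
    (Q : ∀ k : Fin K, Matrix (Fin (N k.succ)) (Fin (N k.castSucc)) ℂ) :
    Matrix (Fin (N (Fin.last K))) (Fin (N 0)) ℂ :=
  Fin.induction (motive := fun i => Matrix (Fin (N i)) (Fin (N 0)) ℂ)
    1 (fun k P => Q k * P) (Fin.last K)

/-- The Gram determinant `det (A† A)` as a real number. The matrix `A† A` is Hermitian positive
semidefinite, so its complex determinant is a nonnegative real number, equal to its real part. -/
noncomputable def gramDet {m n : ℕ} (A : Matrix (Fin m) (Fin n) ℂ) : ℝ :=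
  (Aᴴ * A).det.re

/-!
If `A` has nonzero Gram determinant then `A = U R` with `Uᴴ U = 1` and `R` square, so
`det ((Q A)ᴴ (Q A)) = det ((Q U)ᴴ (Q U)) * det (Aᴴ A)`. By unitary invariance of the Gaussian law,
visible on the characteristic function `T ↦ exp (-tr (Tᴴ T) / 4)`, the matrix `Q U` is again a
Rayleigh channel. Conditioning on `A`, the Gram determinant of `Q A` is distributed as the product
of two independent Gram determinants, and expectations of logarithms add up factor by factor.

The logarithm of a Gaussian Gram determinant is integrable: `det (Aᴴ A) ≤ exp (tr (Aᴴ A) - n)`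
bounds it above, and a finite moment of negative order bounds it below. For that moment one drops
rows to reach a square matrix, whose determinant is affine in its corner entry with the
complementary minor as slope. Integrating the corner entry out reduces the size by one, at the cost
of a factor controlled by the integrability of `|z| ^ (-s)` near `0` in the plane for `s < 2`.
-/

section Measurability

variable {ι κ α : Type*} {l m n : ℕ}

instance borelSpace_matrix [Countable ι] [Countable κ] [TopologicalSpace α] [MeasurableSpace α]
    [SecondCountableTopology α] [BorelSpace α] : BorelSpace (Matrix ι κ α) :=
  inferInstanceAs (BorelSpace (ι → κ → α))

instance secondCountableTopology_matrix [Countable ι] [Countable κ] [TopologicalSpace α]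
    [SecondCountableTopology α] : SecondCountableTopology (Matrix ι κ α) :=
  inferInstanceAs (SecondCountableTopology (ι → κ → α))

lemma continuous_gramDet : Continuous (gramDet (m := m) (n := n)) := by
  unfold gramDet
  fun_prop

lemma measurable_gramDet : Measurable (gramDet (m := m) (n := n)) :=
  continuous_gramDet.measurable

lemma measurable_gramDet_mul :
    Measurable fun p : Matrix (Fin l) (Fin m) ℂ × Matrix (Fin m) (Fin n) ℂ =>
      gramDet (p.1 * p.2) :=
  (continuous_gramDet.comp (by fun_prop)).measurable

end Measurability

section Independence

variable {Ω Ω' : Type*} [MeasurableSpace Ω] [MeasurableSpace Ω'] {μ : Measure Ω} {ν : Measure Ω'}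

lemma indepFun_of_dependsOn {ι F : Type*} {E : ι → Type*} [∀ i, MeasurableSpace (E i)]
    [MeasurableSpace F] {X : ∀ i, Ω → E i} (hindep : iIndepFun X μ)
    (hX : ∀ i, AEMeasurable (X i) μ) {S : Finset ι} {φ : (∀ i, E i) → F} (hφ : Measurable φ)
    (hS : DependsOn φ S) {i : ι} (hi : i ∉ S) :
    IndepFun (X i) (fun ω => φ fun j => X j ω) μ := by
  classical
  have := hindep.isProbabilityMeasure
  obtain ⟨ω₀⟩ := μ.nonempty_of_neZero
  have hrestrict := hindep.indepFun_finset₀ {i} S (Finset.disjoint_singleton_left.2 hi) hX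
  have hφX : (fun ω => φ fun j => X j ω) =
      fun ω => φ (Function.updateFinset (fun j => X j ω₀) S fun j => X j ω) := by
    funext ω
    refine hS fun j hj => ?_
    rw [Function.updateFinset, dif_pos (Finset.mem_coe.1 hj)]
  rw [hφX]
  exact hrestrict.comp (measurable_pi_apply ⟨i, Finset.mem_singleton_self i⟩)
    (hφ.comp measurable_updateFinset)

variable {E E' F G : Type*} [MeasurableSpace E] [MeasurableSpace E'] [MeasurableSpace F]
  [MeasurableSpace G] [IsFiniteMeasure μ] {X : Ω → E} {A : Ω → F}

lemma lintegral_of_indepFun (hX : AEMeasurable X μ) (hA : AEMeasurable A μ)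
    (hXA : IndepFun X A μ) {f : E × F → ENNReal} (hf : Measurable f) :
    ∫⁻ ω, f (X ω, A ω) ∂μ = ∫⁻ a, ∫⁻ ω, f (X ω, a) ∂μ ∂μ.map A := by
  calc ∫⁻ ω, f (X ω, A ω) ∂μ = ∫⁻ p, f p ∂(μ.map X).prod (μ.map A) := by
        rw [← (indepFun_iff_map_prod_eq_prod_map_map hX hA).1 hXA,
          lintegral_map' hf.aemeasurable (hX.prodMk hA)]
    _ = ∫⁻ a, ∫⁻ ω, f (X ω, a) ∂μ ∂μ.map A := by
        rw [lintegral_prod_symm' f hf]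
        exact lintegral_congr fun a =>
          lintegral_map' (hf.comp measurable_prodMk_right).aemeasurable hX

lemma identDistrib_of_indepFun [IsFiniteMeasure ν] {Y : Ω' → E'} {B : Ω' → F}
    (hX : AEMeasurable X μ) (hY : AEMeasurable Y ν) (hXA : IndepFun X A μ) (hYB : IndepFun Y B ν)
    (hAB : IdentDistrib A B μ ν) {f : E × F → G} {g : E' × F → G} (hf : Measurable f)
    (hg : Measurable g)
    (hfg : ∀ a, IdentDistrib (fun ω => f (X ω, a)) (fun ω => g (Y ω, a)) μ ν) :
    IdentDistrib (fun ω => f (X ω, A ω)) (fun ω => g (Y ω, B ω)) μ ν := by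
  have hfXA := hf.comp_aemeasurable (hX.prodMk hAB.aemeasurable_fst)
  have hgYB := hg.comp_aemeasurable (hY.prodMk hAB.aemeasurable_snd)
  refine ⟨hfXA, hgYB, Measure.ext_of_lintegral _ fun h hh => ?_⟩
  calc ∫⁻ x, h x ∂μ.map (fun ω => f (X ω, A ω)) = ∫⁻ ω, h (f (X ω, A ω)) ∂μ :=
        lintegral_map' hh.aemeasurable hfXA
    _ = ∫⁻ a, ∫⁻ ω, h (f (X ω, a)) ∂μ ∂μ.map A :=
        lintegral_of_indepFun hX hAB.aemeasurable_fst hXA (hh.comp hf)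
    _ = ∫⁻ b, ∫⁻ ω, h (g (Y ω, b)) ∂ν ∂ν.map B := by
        rw [hAB.map_eq]
        exact lintegral_congr fun b => ((hfg b).comp hh).lintegral_eq
    _ = ∫⁻ ω, h (g (Y ω, B ω)) ∂ν :=
        (lintegral_of_indepFun hY hAB.aemeasurable_snd hYB (hh.comp hg)).symm
    _ = ∫⁻ x, h x ∂ν.map (fun ω => g (Y ω, B ω)) :=
        (lintegral_map' hh.aemeasurable hgYB).symm

end Independence

section HasIntegrableLog

variable {Ω Ω' : Type*} [MeasurableSpace Ω] [MeasurableSpace Ω'] {μ : Measure Ω} {ν : Measure Ω'}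
  {Y : Ω' → ℝ} {X : Ω → ℝ}

/-- A real random variable that is almost surely positive and whose logarithm is integrable.
Positivity is part of the notion because `Real.log` takes junk values on `(-∞, 0]`. -/
structure HasIntegrableLog (X : Ω → ℝ) (μ : Measure Ω) : Prop where
  ae_pos : ∀ᵐ ω ∂μ, 0 < X ω
  integrable_log : Integrable (fun ω => Real.log (X ω)) μ

lemma identDistrib_log (h : IdentDistrib X Y μ ν) :
    IdentDistrib (fun ω => Real.log (X ω)) (fun ω => Real.log (Y ω)) μ ν :=
  h.comp Real.measurable_log

lemma HasIntegrableLog.of_identDistrib (hY : HasIntegrableLog Y ν) (h : IdentDistrib X Y μ ν) :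
    HasIntegrableLog X μ where
  ae_pos := h.symm.ae_snd measurableSet_Ioi hY.ae_pos
  integrable_log := (identDistrib_log h).integrable_iff.2 hY.integrable_log

lemma HasIntegrableLog.log_mul_prod_ae_eq [SFinite μ] [SFinite ν] (hX : HasIntegrableLog X μ)
    (hY : HasIntegrableLog Y ν) :
    (fun p : Ω × Ω' => Real.log (X p.1 * Y p.2)) =ᵐ[μ.prod ν]
      fun p => Real.log (X p.1) + Real.log (Y p.2) := by
  filter_upwards [Measure.quasiMeasurePreserving_fst.ae hX.ae_pos,
    Measure.quasiMeasurePreserving_snd.ae hY.ae_pos] with p hXp hYp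
  exact Real.log_mul hXp.ne' hYp.ne'

lemma HasIntegrableLog.mul_prod [IsFiniteMeasure μ] [IsFiniteMeasure ν]
    (hX : HasIntegrableLog X μ) (hY : HasIntegrableLog Y ν) :
    HasIntegrableLog (fun p : Ω × Ω' => X p.1 * Y p.2) (μ.prod ν) where
  ae_pos := by
    filter_upwards [Measure.quasiMeasurePreserving_fst.ae hX.ae_pos,
      Measure.quasiMeasurePreserving_snd.ae hY.ae_pos] with p hXp hYp
    exact mul_pos hXp hYp
  integrable_log := ((hX.integrable_log.comp_fst ν).add (hY.integrable_log.comp_snd μ)).congr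
    (hX.log_mul_prod_ae_eq hY).symm

lemma HasIntegrableLog.integral_log_mul_prod [IsProbabilityMeasure μ] [IsProbabilityMeasure ν]
    (hX : HasIntegrableLog X μ) (hY : HasIntegrableLog Y ν) :
    ∫ p, Real.log (X p.1 * Y p.2) ∂μ.prod ν =
      ∫ ω, Real.log (X ω) ∂μ + ∫ ω, Real.log (Y ω) ∂ν := by
  rw [integral_congr_ae (hX.log_mul_prod_ae_eq hY),
    integral_add (hX.integrable_log.comp_fst ν) (hY.integrable_log.comp_snd μ),
    integral_fun_fst fun ω => Real.log (X ω), integral_fun_snd fun ω => Real.log (Y ω),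
    probReal_univ, probReal_univ, one_smul, one_smul]

lemma HasIntegrableLog.of_lintegral_rpow_neg (hX : AEMeasurable X μ) (hX_nonneg : 0 ≤ X) {s : ℝ}
    (hs : 0 < s) (hmoment : ∫⁻ ω, ‖X ω‖ₑ ^ (-s) ∂μ ≠ ⊤) {Z : Ω → ℝ} (hZ : Integrable Z μ)
    (hXZ : ∀ ω, X ω ≤ Real.exp (Z ω)) : HasIntegrableLog X μ := by
  have hpow : AEMeasurable (fun ω => ‖X ω‖ₑ ^ (-s)) μ := hX.enorm.pow_const _
  have hpos : ∀ᵐ ω ∂μ, 0 < X ω := by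
    filter_upwards [ae_lt_top' hpow hmoment] with ω hω
    refine (hX_nonneg ω).lt_of_ne fun h => hω.ne ?_
    rw [← h, Pi.zero_apply, enorm_zero, ENNReal.zero_rpow_of_neg (neg_neg_of_pos hs)]
  refine ⟨hpos, integrable_of_le_of_le hX.log.aestronglyMeasurable ?_ ?_
    (((integrable_toReal_of_lintegral_ne_top hpow hmoment).div_const s).neg) hZ⟩
  · filter_upwards [hpos] with ω hω
    have hlog := Real.log_le_rpow_div (inv_nonneg.2 hω.le) hs
    rw [Real.log_inv, Real.inv_rpow hω.le, ← Real.rpow_neg hω.le] at hlog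
    simp only [Pi.neg_apply, ← ENNReal.toReal_rpow, toReal_enorm, Real.norm_of_nonneg hω.le]
    linarith
  · filter_upwards [hpos] with ω hω
    exact (Real.log_le_iff_le_exp hω).2 (hXZ ω)

end HasIntegrableLog

section GramDet

open scoped ComplexOrder MatrixOrder

variable {l m n : ℕ}

lemma coe_gramDet (A : Matrix (Fin m) (Fin n) ℂ) : (gramDet A : ℂ) = (Aᴴ * A).det := by
  rw [gramDet, (Matrix.isHermitian_conjTranspose_mul_self A).det_eq_prod_eigenvalues]
  norm_cast

lemma gramDet_eq_prod_eigenvalues (A : Matrix (Fin m) (Fin n) ℂ) :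
    gramDet A = ∏ i, (Matrix.isHermitian_conjTranspose_mul_self A).eigenvalues i := by
  rw [gramDet, (Matrix.isHermitian_conjTranspose_mul_self A).det_eq_prod_eigenvalues]
  norm_cast

lemma gramDet_nonneg (A : Matrix (Fin m) (Fin n) ℂ) : 0 ≤ gramDet A := by
  rw [gramDet_eq_prod_eigenvalues]
  exact Finset.prod_nonneg fun i _ =>
    (Matrix.posSemidef_conjTranspose_mul_self A).eigenvalues_nonneg i

lemma gramDet_eq_zero_iff {A : Matrix (Fin m) (Fin n) ℂ} :
    gramDet A = 0 ↔ ∃ v ≠ 0, A.mulVec v = 0 := by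
  simp only [← Matrix.conjTranspose_mul_self_mulVec_eq_zero A]
  rw [Matrix.exists_mulVec_eq_zero_iff, ← coe_gramDet, Complex.ofReal_eq_zero]

lemma gramDet_mul_eq_zero {A : Matrix (Fin m) (Fin n) ℂ} (hA : gramDet A = 0)
    (B : Matrix (Fin l) (Fin m) ℂ) : gramDet (B * A) = 0 := by
  obtain ⟨v, hv, hAv⟩ := gramDet_eq_zero_iff.1 hA
  exact gramDet_eq_zero_iff.2 ⟨v, hv, by rw [← Matrix.mulVec_mulVec, hAv, Matrix.mulVec_zero]⟩

lemma gramDet_mul_square (A : Matrix (Fin m) (Fin n) ℂ) (B : Matrix (Fin n) (Fin n) ℂ) :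
    gramDet (A * B) = gramDet A * gramDet B := by
  rw [← Complex.ofReal_inj]
  push_cast
  rw [coe_gramDet, coe_gramDet, coe_gramDet, Matrix.conjTranspose_mul, Matrix.mul_assoc,
    ← Matrix.mul_assoc Aᴴ, Matrix.det_mul, Matrix.det_mul, Matrix.det_mul]
  ring

lemma gramDet_square (A : Matrix (Fin n) (Fin n) ℂ) : gramDet A = ‖A.det‖ ^ 2 := by
  rw [← Complex.ofReal_inj, coe_gramDet, Matrix.det_mul, Matrix.det_conjTranspose, mul_comm]
  simpa using Complex.mul_conj' A.det

lemma gramDet_isometry {U : Matrix (Fin m) (Fin n) ℂ} (hU : Uᴴ * U = 1) : gramDet U = 1 := by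
  simp [gramDet, hU]

lemma exists_isometry_mul_eq {A : Matrix (Fin m) (Fin n) ℂ} (hA : gramDet A ≠ 0) :
    ∃ (U : Matrix (Fin m) (Fin n) ℂ) (R : Matrix (Fin n) (Fin n) ℂ), Uᴴ * U = 1 ∧ U * R = A := by
  obtain ⟨R, hR⟩ := CStarAlgebra.nonneg_iff_eq_star_mul_self.mp
    (Matrix.posSemidef_conjTranspose_mul_self A).nonneg
  rw [Matrix.star_eq_conjTranspose] at hR
  have hR_unit : IsUnit R.det := by
    rw [isUnit_iff_ne_zero]
    intro h
    exact hA (by rw [gramDet, hR, Matrix.det_mul, h, mul_zero, Complex.zero_re])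
  refine ⟨A * R⁻¹, R, ?_, Matrix.nonsing_inv_mul_cancel_right _ _ hR_unit⟩
  calc (A * R⁻¹)ᴴ * (A * R⁻¹) = (R⁻¹)ᴴ * (Aᴴ * A) * R⁻¹ := by
        simp only [Matrix.conjTranspose_mul, Matrix.mul_assoc]
    _ = (R * R⁻¹)ᴴ * (R * R⁻¹) := by
        simp only [hR, Matrix.conjTranspose_mul, Matrix.mul_assoc]
    _ = 1 := by rw [Matrix.mul_nonsing_inv _ hR_unit, Matrix.conjTranspose_one, Matrix.one_mul]

lemma re_trace_conjTranspose_mul_self (A : Matrix (Fin m) (Fin n) ℂ) :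
    (Aᴴ * A).trace.re = ∑ i, ∑ j, ‖A i j‖ ^ 2 := by
  rw [Finset.sum_comm]
  simp [Matrix.trace, Matrix.mul_apply, ← Complex.normSq_eq_norm_sq, Complex.normSq_apply]

lemma gramDet_le_exp (A : Matrix (Fin m) (Fin n) ℂ) :
    gramDet A ≤ Real.exp ((Aᴴ * A).trace.re - n) := by
  have hherm := Matrix.isHermitian_conjTranspose_mul_self A
  have htrace : (Aᴴ * A).trace.re = ∑ i, hherm.eigenvalues i := by
    rw [hherm.trace_eq_sum_eigenvalues]
    simp
  calc gramDet A = ∏ i, hherm.eigenvalues i := gramDet_eq_prod_eigenvalues A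
    _ ≤ ∏ i, Real.exp (hherm.eigenvalues i - 1) := by
        refine Finset.prod_le_prod (fun i _ => ?_) fun i _ => ?_
        · exact (Matrix.posSemidef_conjTranspose_mul_self A).eigenvalues_nonneg i
        · linarith [Real.add_one_le_exp (hherm.eigenvalues i - 1)]
    _ = Real.exp ((Aᴴ * A).trace.re - n) := by
        rw [← Real.exp_sum, Finset.sum_sub_distrib, htrace]
        simp

lemma gramDet_submatrix_isometry_le_one {U : Matrix (Fin m) (Fin n) ℂ} (hU : Uᴴ * U = 1)
    {f : Fin l → Fin m} (hf : Function.Injective f) : gramDet (U.submatrix f id) ≤ 1 := by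
  refine (gramDet_le_exp _).trans (Real.exp_le_one_iff.2 (sub_nonpos.2 ?_))
  calc ((U.submatrix f id)ᴴ * U.submatrix f id).trace.re = ∑ i, ∑ j, ‖U (f i) j‖ ^ 2 :=
        re_trace_conjTranspose_mul_self _
    _ ≤ ∑ i, ∑ j, ‖U i j‖ ^ 2 := by
        rw [← Finset.sum_image (s := Finset.univ) (g := f) (f := fun i => ∑ j, ‖U i j‖ ^ 2)
          hf.injOn]
        exact Finset.sum_le_sum_of_subset_of_nonneg (Finset.subset_univ _) fun i _ _ => by
          positivity
    _ = n := by rw [← re_trace_conjTranspose_mul_self, hU]; simp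

lemma gramDet_submatrix_le (A : Matrix (Fin m) (Fin n) ℂ) {f : Fin l → Fin m}
    (hf : Function.Injective f) : gramDet (A.submatrix f id) ≤ gramDet A := by
  by_cases hA : gramDet A = 0
  · obtain ⟨v, hv, hAv⟩ := gramDet_eq_zero_iff.1 hA
    refine (gramDet_eq_zero_iff.2 ⟨v, hv, ?_⟩).le.trans hA.ge
    exact funext fun i => congrFun hAv (f i)
  · obtain ⟨U, R, hU, rfl⟩ := exists_isometry_mul_eq hA
    have hrows : (U * R).submatrix f id = U.submatrix f id * R := rfl
    rw [hrows, gramDet_mul_square, gramDet_mul_square, gramDet_isometry hU]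
    exact mul_le_mul_of_nonneg_right (gramDet_submatrix_isometry_le_one hU hf) (gramDet_nonneg R)

end GramDet

section StdComplexGaussian

instance isProbabilityMeasure_stdComplexGaussian : IsProbabilityMeasure stdComplexGaussian :=
  Measure.isProbabilityMeasure_map Complex.measurableEquivRealProd.symm.measurable.aemeasurable

lemma charFun_stdComplexGaussian (t : ℂ) :
    charFun stdComplexGaussian t = Complex.exp (-(‖t‖ ^ 2 / 4 : ℝ)) := by
  have hreal (s : ℝ) : ∫ x, Complex.exp (s * x * Complex.I) ∂gaussianReal 0 (1 / 2) =
      Complex.exp (-(s ^ 2 / 4 : ℝ)) := by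
    rw [← charFun_apply_real, charFun_gaussianReal]
    push_cast
    ring_nf
  have hinner (p : ℝ × ℝ) : Complex.exp
      ((inner ℝ (Complex.measurableEquivRealProd.symm p) t : ℝ) * Complex.I) =
      Complex.exp (t.re * p.1 * Complex.I) * Complex.exp (t.im * p.2 * Complex.I) := by
    rw [← Complex.exp_add, Complex.inner]
    simp only [Complex.measurableEquivRealProd_symm_apply, Complex.mul_re,
      Complex.conj_re, Complex.conj_im]
    push_cast
    ring_nf
  rw [charFun_apply, stdComplexGaussian, integral_map_equiv]
  simp only [hinner]
  rw [integral_prod_mul (fun x : ℝ => Complex.exp (t.re * x * Complex.I))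
    (fun x : ℝ => Complex.exp (t.im * x * Complex.I)), hreal, hreal, ← Complex.exp_add,
    ← Complex.normSq_eq_norm_sq, Complex.normSq_apply]
  push_cast
  ring_nf

lemma integrable_norm_sq_stdComplexGaussian :
    Integrable (fun z : ℂ => ‖z‖ ^ 2) stdComplexGaussian := by
  rw [stdComplexGaussian, integrable_map_equiv]
  have hsq : Integrable (fun x : ℝ => x ^ 2) (gaussianReal 0 (1 / 2)) :=
    (memLp_id_gaussianReal 2).integrable_sq
  refine ((hsq.comp_fst _).add (hsq.comp_snd _)).congr (ae_of_all _ fun p => ?_)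
  rw [Function.comp_apply, ← Complex.normSq_eq_norm_sq, Complex.normSq_apply, ← sq, ← sq]
  rfl

lemma gaussianReal_half_le_volume : gaussianReal 0 (1 / 2) ≤ volume := by
  rw [gaussianReal_of_var_ne_zero _ (by norm_num)]
  calc volume.withDensity (gaussianPDF 0 (1 / 2)) ≤ volume.withDensity 1 := by
        refine withDensity_mono (ae_of_all _ fun x => ?_)
        rw [gaussianPDF, Pi.one_apply, ENNReal.ofReal_le_one, gaussianPDFReal]
        refine mul_le_one₀ (inv_le_one_of_one_le₀ (Real.one_le_sqrt.2 ?_)) (Real.exp_nonneg _)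
          (Real.exp_le_one_iff.2 ?_)
        · push_cast; linarith [Real.pi_gt_three]
        · exact div_nonpos_of_nonpos_of_nonneg (neg_nonpos.2 (sq_nonneg _)) (by positivity)
    _ = volume := withDensity_one

lemma stdComplexGaussian_le_volume : stdComplexGaussian ≤ volume :=
  calc stdComplexGaussian
      ≤ ((volume : Measure ℝ).prod volume).map Complex.measurableEquivRealProd.symm :=
        Measure.map_mono (Measure.prod_mono gaussianReal_half_le_volume
          gaussianReal_half_le_volume) (MeasurableEquiv.measurable _)
    _ = volume := Complex.volume_preserving_equiv_real_prod.symm.map_eq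

lemma lintegral_ball_enorm_rpow_neg_ne_top {s : ℝ} (hs : s < 2) :
    ∫⁻ z in Metric.ball (0 : ℂ) 1, ‖z‖ₑ ^ (-s) ≠ ⊤ := by
  have hradial : IntegrableOn (fun r : ℝ => r ^ (Module.finrank ℝ ℂ - 1) • r ^ (-s))
      (Set.Ioo 0 1) := by
    refine ((intervalIntegral.integrableOn_Ioo_rpow_iff (s := 1 - s) one_pos).2
      (by linarith)).congr_fun (fun r hr => ?_) measurableSet_Ioo
    change r ^ (1 - s) = r ^ (Module.finrank ℝ ℂ - 1) * r ^ (-s)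
    rw [Complex.finrank_real_complex, pow_one, sub_eq_add_neg, Real.rpow_add hr.1, Real.rpow_one]
  have hball := ((integrableOn_fun_norm_addHaar (volume : Measure ℂ)).2 hradial).2
  refine ((lintegral_congr_ae (ae_restrict_of_ae ?_)).trans_lt hball).ne
  filter_upwards [Measure.ae_ne volume 0] with z hz
  rw [← ofReal_norm, ENNReal.ofReal_rpow_of_pos (norm_pos_iff.2 hz),
    Real.enorm_of_nonneg (by positivity)]

lemma lintegral_enorm_add_rpow_neg_le {s : ℝ} (hs : 0 < s) (w : ℂ) :
    ∫⁻ z, ‖z + w‖ₑ ^ (-s) ∂stdComplexGaussian ≤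
      1 + ∫⁻ z in Metric.ball (0 : ℂ) 1, ‖z‖ₑ ^ (-s) := by
  let f (z : ℂ) : ENNReal := (Metric.ball 0 1).indicator (fun z => ‖z‖ₑ ^ (-s)) z
  have hpow (z : ℂ) : ‖z‖ₑ ^ (-s) ≤ 1 + f z := by
    by_cases hz : z ∈ Metric.ball (0 : ℂ) 1
    · simp only [f, Set.indicator_of_mem hz, le_add_self]
    · refine (ENNReal.rpow_le_one_of_one_le_of_neg ?_ (neg_neg_of_pos hs)).trans le_self_add
      rw [mem_ball_zero_iff, not_lt] at hz
      rw [← ofReal_norm]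
      exact ENNReal.one_le_ofReal.2 hz
  calc ∫⁻ z, ‖z + w‖ₑ ^ (-s) ∂stdComplexGaussian
      ≤ ∫⁻ z, 1 + f (z + w) ∂stdComplexGaussian := lintegral_mono fun z => hpow (z + w)
    _ = 1 + ∫⁻ z, f (z + w) ∂stdComplexGaussian := by
        rw [lintegral_add_left measurable_const, lintegral_const, measure_univ, mul_one]
    _ ≤ 1 + ∫⁻ z, f (z + w) := by
        gcongr
        exact stdComplexGaussian_le_volume
    _ = 1 + ∫⁻ z in Metric.ball (0 : ℂ) 1, ‖z‖ₑ ^ (-s) := by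
        rw [lintegral_add_right_eq_self f w, lintegral_indicator measurableSet_ball]

lemma lintegral_enorm_mul_add_rpow_neg_le {s : ℝ} (hs : 0 < s) (c b : ℂ) :
    ∫⁻ z, ‖z * c + b‖ₑ ^ (-s) ∂stdComplexGaussian ≤
      (1 + ∫⁻ z in Metric.ball (0 : ℂ) 1, ‖z‖ₑ ^ (-s)) * ‖c‖ₑ ^ (-s) := by
  rcases eq_or_ne c 0 with rfl | hc
  · rw [enorm_zero, ENNReal.zero_rpow_of_neg (neg_neg_of_pos hs), ENNReal.mul_top (by simp)]
    exact le_top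
  have hfactor (z : ℂ) : ‖z * c + b‖ₑ ^ (-s) = ‖z + b / c‖ₑ ^ (-s) * ‖c‖ₑ ^ (-s) := by
    rw [← ENNReal.mul_rpow_of_ne_top enorm_ne_top enorm_ne_top, ← enorm_mul, add_mul,
      div_mul_cancel₀ b hc]
  simp only [hfactor]
  rw [lintegral_mul_const _ (by fun_prop)]
  gcongr
  exact lintegral_enorm_add_rpow_neg_le hs _

end StdComplexGaussian

namespace IsRayleighMIMO

variable {Ω Ω' : Type*} [MeasurableSpace Ω] [MeasurableSpace Ω'] {μ : Measure Ω} {ν : Measure Ω'}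
  {m n : ℕ} {Q : Ω → Matrix (Fin m) (Fin n) ℂ} {Q' : Ω' → Matrix (Fin m) (Fin n) ℂ}

lemma isProbabilityMeasure (hQ : IsRayleighMIMO Q μ) : IsProbabilityMeasure μ :=
  hQ.2.isProbabilityMeasure

lemma aemeasurable (hQ : IsRayleighMIMO Q μ) : AEMeasurable Q μ :=
  aemeasurable_pi_lambda _ fun i => aemeasurable_pi_lambda _ fun j => (hQ.1 i j).aemeasurable

lemma hasLaw_entries (hQ : IsRayleighMIMO Q μ) :
    HasLaw (fun ω (p : Fin m × Fin n) => Q ω p.1 p.2) (Measure.pi fun _ => stdComplexGaussian) μ :=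
  hQ.2.hasLaw_pi fun p => hQ.1 p.1 p.2

lemma of_hasLaw_entries
    (hQ : HasLaw (fun ω (p : Fin m × Fin n) => Q ω p.1 p.2)
      (Measure.pi fun _ => stdComplexGaussian) μ) : IsRayleighMIMO Q μ := by
  have := hQ.isProbabilityMeasure
  have hentry (p : Fin m × Fin n) : HasLaw (fun ω => Q ω p.1 p.2) stdComplexGaussian μ :=
    (measurePreserving_eval (fun _ => stdComplexGaussian) p).fun_comp_hasLaw hQ
  exact ⟨fun i j => hentry (i, j), (iIndepFun_iff_hasLaw_pi_pi hentry).2 hQ⟩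

lemma identDistrib (hQ : IsRayleighMIMO Q μ) (hQ' : IsRayleighMIMO Q' ν) :
    IdentDistrib Q Q' μ ν :=
  have hof : Continuous fun f : Fin m × Fin n → ℂ => Matrix.of fun i j => f (i, j) := by fun_prop
  (hQ.hasLaw_entries.identDistrib hQ'.hasLaw_entries).comp hof.measurable

lemma comp_fst [IsProbabilityMeasure ν] (hQ : IsRayleighMIMO Q μ) :
    IsRayleighMIMO (fun p : Ω × Ω' => Q p.1) (μ.prod ν) :=
  have := hQ.isProbabilityMeasure
  of_hasLaw_entries (hQ.hasLaw_entries.fun_comp measurePreserving_fst.hasLaw)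

lemma submatrix {m' n' : ℕ} (hQ : IsRayleighMIMO Q μ) {f : Fin m' → Fin m}
    {g : Fin n' → Fin n} (hf : Function.Injective f) (hg : Function.Injective g) :
    IsRayleighMIMO (fun ω => (Q ω).submatrix f g) μ :=
  ⟨fun i j => hQ.1 (f i) (g j), hQ.2.precomp (hf.prodMap hg)⟩

end IsRayleighMIMO

lemma prod_charFun_stdComplexGaussian {m n : ℕ} (T : Matrix (Fin m) (Fin n) ℂ) :
    ∏ p : Fin m × Fin n, charFun stdComplexGaussian (T p.1 p.2) =
      Complex.exp (-((Tᴴ * T).trace.re / 4 : ℝ)) := by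
  simp only [charFun_stdComplexGaussian]
  rw [← Complex.exp_sum, re_trace_conjTranspose_mul_self, ← Fintype.sum_prod_type',
    Finset.sum_div]
  push_cast
  rw [Finset.sum_neg_distrib]

lemma isRayleighMIMO_iff_integral_exp_trace {Ω : Type*} [MeasurableSpace Ω] {μ : Measure Ω}
    [IsFiniteMeasure μ] {m n : ℕ} {Q : Ω → Matrix (Fin m) (Fin n) ℂ}
    (hQ : AEMeasurable Q μ) :
    IsRayleighMIMO Q μ ↔ ∀ T : Matrix (Fin m) (Fin n) ℂ,
      ∫ ω, Complex.exp ((Tᴴ * Q ω).trace.re * Complex.I) ∂μ =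
        Complex.exp (-((Tᴴ * T).trace.re / 4 : ℝ)) := by
  have hentries_cont : Continuous fun (A : Matrix (Fin m) (Fin n) ℂ) (p : Fin m × Fin n) =>
      A p.1 p.2 := by fun_prop
  have hentries : AEMeasurable (fun ω (p : Fin m × Fin n) => Q ω p.1 p.2) μ :=
    hentries_cont.measurable.comp_aemeasurable hQ
  have hcharFun (T : Matrix (Fin m) (Fin n) ℂ) :
      charFun ((μ.map fun ω (p : Fin m × Fin n) => Q ω p.1 p.2).map (WithLp.toLp 2))
        (WithLp.toLp 2 fun p => T p.1 p.2) =
      ∫ ω, Complex.exp ((Tᴴ * Q ω).trace.re * Complex.I) ∂μ := by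
    rw [charFun_apply, ← MeasurableEquiv.coe_toLp, integral_map_equiv, integral_map hentries
      (by apply Measurable.aestronglyMeasurable; fun_prop)]
    congr! 5 with ω
    rw [PiLp.inner_apply, Fintype.sum_prod_type, Finset.sum_comm]
    simp [Matrix.trace, Matrix.mul_apply, Complex.inner, mul_comm]
  have hlaw : IsRayleighMIMO Q μ ↔ μ.map (fun ω (p : Fin m × Fin n) => Q ω p.1 p.2) =
      Measure.pi fun _ => stdComplexGaussian :=
    ⟨fun h => h.hasLaw_entries.map_eq, fun h => .of_hasLaw_entries ⟨hentries, h⟩⟩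
  rw [hlaw, ← charFun_eq_pi_iff]
  refine ⟨fun h T => ?_, fun h t => ?_⟩
  · rw [← hcharFun, ← prod_charFun_stdComplexGaussian]
    exact h _
  · let T : Matrix (Fin m) (Fin n) ℂ := Matrix.of fun i j => t (i, j)
    exact (hcharFun T).trans ((h T).trans (prod_charFun_stdComplexGaussian T).symm)

namespace IsRayleighMIMO

variable {Ω Ω' : Type*} [MeasurableSpace Ω] [MeasurableSpace Ω'] {μ : Measure Ω} {ν : Measure Ω'}
  {l m n : ℕ}

lemma mul_isometry {Q : Ω → Matrix (Fin l) (Fin m) ℂ} (hQ : IsRayleighMIMO Q μ)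
    {U : Matrix (Fin m) (Fin n) ℂ} (hU : Uᴴ * U = 1) : IsRayleighMIMO (fun ω => Q ω * U) μ := by
  have := hQ.isProbabilityMeasure
  have hcont : Continuous fun A : Matrix (Fin l) (Fin m) ℂ => A * U := by fun_prop
  have hmeas : AEMeasurable (fun ω => Q ω * U) μ :=
    hcont.measurable.comp_aemeasurable hQ.aemeasurable
  refine (isRayleighMIMO_iff_integral_exp_trace hmeas).2 fun T => ?_
  have htrace (ω : Ω) : (Tᴴ * (Q ω * U)).trace = ((T * Uᴴ)ᴴ * Q ω).trace := by
    rw [← Matrix.mul_assoc, Matrix.trace_mul_comm, ← Matrix.mul_assoc, Matrix.conjTranspose_mul,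
      Matrix.conjTranspose_conjTranspose]
  have hnorm : ((T * Uᴴ)ᴴ * (T * Uᴴ)).trace = (Tᴴ * T).trace := by
    rw [Matrix.conjTranspose_mul, Matrix.conjTranspose_conjTranspose, Matrix.mul_assoc,
      Matrix.trace_mul_comm, Matrix.mul_assoc, Matrix.mul_assoc, hU, Matrix.mul_one]
  simp only [htrace]
  rw [(isRayleighMIMO_iff_integral_exp_trace hQ.aemeasurable).1 hQ, hnorm]

lemma identDistrib_gramDet_mul {Q : Ω → Matrix (Fin l) (Fin m) ℂ} (hQ : IsRayleighMIMO Q μ)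
    {Q' : Ω' → Matrix (Fin l) (Fin n) ℂ} (hQ' : IsRayleighMIMO Q' ν)
    (A : Matrix (Fin m) (Fin n) ℂ) :
    IdentDistrib (fun ω => gramDet (Q ω * A)) (fun ω => gramDet (Q' ω) * gramDet A) μ ν := by
  by_cases hA : gramDet A = 0
  · have := hQ.isProbabilityMeasure
    have := hQ'.isProbabilityMeasure
    simp only [gramDet_mul_eq_zero hA, hA, mul_zero]
    exact ⟨aemeasurable_const, aemeasurable_const, by simp [Measure.map_const]⟩
  · obtain ⟨U, R, hU, rfl⟩ := exists_isometry_mul_eq hA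
    simp only [← Matrix.mul_assoc, gramDet_mul_square, gramDet_isometry hU, one_mul]
    exact (((hQ.mul_isometry hU).identDistrib hQ').comp measurable_gramDet).mul_const _

lemma identDistrib_gramDet_mul_of_indepFun {Q : Ω → Matrix (Fin l) (Fin m) ℂ}
    (hQ : IsRayleighMIMO Q μ) {Q' : Ω' → Matrix (Fin l) (Fin n) ℂ} (hQ' : IsRayleighMIMO Q' ν)
    {A : Ω → Matrix (Fin m) (Fin n) ℂ} (hA : AEMeasurable A μ) (hQA : IndepFun Q A μ) :
    IdentDistrib (fun ω => gramDet (Q ω * A ω))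
      (fun p : Ω' × Ω => gramDet (Q' p.1) * gramDet (A p.2)) μ (ν.prod μ) := by
  have := hQ.isProbabilityMeasure
  have := hQ'.isProbabilityMeasure
  have hQ'_fst : IsRayleighMIMO (fun p : Ω' × Ω => Q' p.1) (ν.prod μ) := hQ'.comp_fst
  have hA_law : HasLaw A (μ.map A) μ := ⟨hA, rfl⟩
  have hA_snd : IdentDistrib A (fun p : Ω' × Ω => A p.2) μ (ν.prod μ) :=
    hA_law.identDistrib (hA_law.fun_comp measurePreserving_snd.hasLaw)
  exact identDistrib_of_indepFun hQ.aemeasurable hQ'_fst.aemeasurable hQA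
    (indepFun_prod₀ hQ'.aemeasurable hA) hA_snd measurable_gramDet_mul
    ((measurable_gramDet.comp measurable_fst).mul (measurable_gramDet.comp measurable_snd))
    (hQ.identDistrib_gramDet_mul hQ'_fst)

end IsRayleighMIMO

/-- The part of the Laplace expansion of `A.det` along the first row that does not involve the
corner entry `A 0 0`. -/
def cornerRemainder {n : ℕ} (A : Matrix (Fin (n + 1)) (Fin (n + 1)) ℂ) : ℂ :=
  ∑ j : Fin n, (-1) ^ (j + 1 : ℕ) * A 0 j.succ * (A.submatrix Fin.succ j.succ.succAbove).det

lemma det_eq_corner_mul_add_cornerRemainder {n : ℕ} (A : Matrix (Fin (n + 1)) (Fin (n + 1)) ℂ) :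
    A.det = A 0 0 * (A.submatrix Fin.succ Fin.succ).det + cornerRemainder A := by
  rw [Matrix.det_succ_row_zero, Fin.sum_univ_succ, Fin.succAbove_zero, Fin.val_zero, pow_zero,
    one_mul]
  rfl

namespace IsRayleighMIMO

variable {Ω : Type*} [MeasurableSpace Ω] {μ : Measure Ω} {m n : ℕ}

lemma indepFun_corner {Q : Ω → Matrix (Fin (n + 1)) (Fin (n + 1)) ℂ} (hQ : IsRayleighMIMO Q μ) :
    IndepFun (fun ω => Q ω 0 0)
      (fun ω => (((Q ω).submatrix Fin.succ Fin.succ).det, cornerRemainder (Q ω))) μ := by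
  let φ (f : Fin (n + 1) × Fin (n + 1) → ℂ) : ℂ × ℂ :=
    ((Matrix.of fun i j : Fin n => f (i.succ, j.succ)).det,
      cornerRemainder (Matrix.of fun i j => f (i, j)))
  have hφ : Continuous φ := by
    unfold φ cornerRemainder
    fun_prop
  have hdep : DependsOn φ (Finset.univ.erase (0, 0) : Finset (Fin (n + 1) × Fin (n + 1))) := by
    intro f g hfg
    have hrow (i : Fin n) (j) : f (i.succ, j) = g (i.succ, j) := hfg _ (by simp)
    have hcol (j : Fin n) : f (0, j.succ) = g (0, j.succ) := hfg _ (by simp)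
    simp [φ, cornerRemainder, Matrix.submatrix, hrow, hcol]
  exact indepFun_of_dependsOn hQ.2 (fun p => (hQ.1 p.1 p.2).aemeasurable) hφ.measurable hdep
    (Finset.notMem_erase _ _)

lemma lintegral_enorm_det_rpow_neg_ne_top {s : ℝ} (hs : 0 < s) (hs' : s < 2)
    {Q : Ω → Matrix (Fin n) (Fin n) ℂ} (hQ : IsRayleighMIMO Q μ) :
    ∫⁻ ω, ‖(Q ω).det‖ₑ ^ (-s) ∂μ ≠ ⊤ := by
  have := hQ.isProbabilityMeasure
  induction n with
  | zero => simp
  | succ n ih =>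
    let C : ENNReal := 1 + ∫⁻ z in Metric.ball (0 : ℂ) 1, ‖z‖ₑ ^ (-s)
    let A (ω : Ω) : ℂ × ℂ := (((Q ω).submatrix Fin.succ Fin.succ).det, cornerRemainder (Q ω))
    have hA : AEMeasurable A μ := by
      have : Continuous fun M : Matrix (Fin (n + 1)) (Fin (n + 1)) ℂ =>
        ((M.submatrix Fin.succ Fin.succ).det, cornerRemainder M) := by
          unfold cornerRemainder
          fun_prop
      exact this.measurable.comp_aemeasurable hQ.aemeasurable
    have hC : C ≠ ⊤ := ENNReal.add_ne_top.2
      ⟨ENNReal.one_ne_top, lintegral_ball_enorm_rpow_neg_ne_top hs'⟩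
    have hminor := ih (hQ.submatrix (Fin.succ_injective n) (Fin.succ_injective n))
    refine ((?_ : _ ≤ _).trans_lt (ENNReal.mul_lt_top hC.lt_top hminor.lt_top)).ne
    calc ∫⁻ ω, ‖(Q ω).det‖ₑ ^ (-s) ∂μ
        = ∫⁻ ω, ‖Q ω 0 0 * (A ω).1 + (A ω).2‖ₑ ^ (-s) ∂μ := by
          simp only [A, det_eq_corner_mul_add_cornerRemainder]
      _ = ∫⁻ a, ∫⁻ ω, ‖Q ω 0 0 * a.1 + a.2‖ₑ ^ (-s) ∂μ ∂μ.map A :=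
          lintegral_of_indepFun (f := fun p => ‖p.1 * p.2.1 + p.2.2‖ₑ ^ (-s))
            (hQ.1 0 0).aemeasurable hA hQ.indepFun_corner (by fun_prop)
      _ ≤ ∫⁻ a, C * ‖a.1‖ₑ ^ (-s) ∂μ.map A := by
          refine lintegral_mono fun a => ?_
          rw [(hQ.1 0 0).lintegral_comp (f := fun z => ‖z * a.1 + a.2‖ₑ ^ (-s)) (by fun_prop)]
          exact lintegral_enorm_mul_add_rpow_neg_le hs a.1 a.2
      _ = C * ∫⁻ ω, ‖((Q ω).submatrix Fin.succ Fin.succ).det‖ₑ ^ (-s) ∂μ := by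
          rw [lintegral_map' (by fun_prop) hA, lintegral_const_mul' _ _ hC]

lemma integrable_re_trace {Q : Ω → Matrix (Fin m) (Fin n) ℂ} (hQ : IsRayleighMIMO Q μ) :
    Integrable (fun ω => ((Q ω)ᴴ * Q ω).trace.re) μ := by
  simp only [re_trace_conjTranspose_mul_self]
  exact integrable_finsetSum _ fun i _ => integrable_finsetSum _ fun j _ =>
    ((hQ.1 i j).map_eq ▸ integrable_norm_sq_stdComplexGaussian).comp_aemeasurable
      (hQ.1 i j).aemeasurable

lemma lintegral_enorm_gramDet_rpow_neg_ne_top (hnm : n ≤ m) {s : ℝ} (hs : 0 < s) (hs' : s < 1)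
    {Q : Ω → Matrix (Fin m) (Fin n) ℂ} (hQ : IsRayleighMIMO Q μ) :
    ∫⁻ ω, ‖gramDet (Q ω)‖ₑ ^ (-s) ∂μ ≠ ⊤ := by
  let T (ω : Ω) : Matrix (Fin n) (Fin n) ℂ := (Q ω).submatrix (Fin.castLE hnm) id
  have hT : IsRayleighMIMO T μ := hQ.submatrix (Fin.castLE_injective hnm) Function.injective_id
  have hmoment : ∫⁻ ω, ‖(T ω).det‖ₑ ^ (-(2 * s)) ∂μ ≠ ⊤ :=
    hT.lintegral_enorm_det_rpow_neg_ne_top (by linarith) (by linarith)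
  refine ((lintegral_mono fun ω => ?_).trans_lt hmoment.lt_top).ne
  have hle : ‖(T ω).det‖ₑ ^ (2 : ℝ) ≤ ‖gramDet (Q ω)‖ₑ := by
    have := gramDet_submatrix_le (Q ω) (Fin.castLE_injective hnm)
    rw [gramDet_square] at this
    rw [ENNReal.rpow_ofNat, ← enorm_pow, ← ofReal_norm, norm_pow,
      Real.enorm_of_nonneg (gramDet_nonneg _)]
    exact ENNReal.ofReal_le_ofReal this
  calc ‖gramDet (Q ω)‖ₑ ^ (-s) ≤ (‖(T ω).det‖ₑ ^ (2 : ℝ)) ^ (-s) := by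
        rw [ENNReal.rpow_neg, ENNReal.rpow_neg]
        exact ENNReal.inv_le_inv.2 (ENNReal.rpow_le_rpow hle hs.le)
    _ = ‖(T ω).det‖ₑ ^ (-(2 * s)) := by rw [← ENNReal.rpow_mul, mul_neg]

lemma hasIntegrableLog_gramDet (hnm : n ≤ m) {Q : Ω → Matrix (Fin m) (Fin n) ℂ}
    (hQ : IsRayleighMIMO Q μ) : HasIntegrableLog (fun ω => gramDet (Q ω)) μ :=
  have := hQ.isProbabilityMeasure
  .of_lintegral_rpow_neg (s := 1 / 2) (measurable_gramDet.comp_aemeasurable hQ.aemeasurable)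
    (fun _ => gramDet_nonneg _) one_half_pos
    (hQ.lintegral_enorm_gramDet_rpow_neg_ne_top hnm one_half_pos one_half_lt_one)
    (hQ.integrable_re_trace.sub (integrable_const (n : ℝ))) fun _ => gramDet_le_exp _

end IsRayleighMIMO

section ChannelProduct

variable {K : ℕ}

lemma gramDet_channelProduct_zero (N : Fin 1 → ℕ)
    (Q : ∀ k : Fin 0, Matrix (Fin (N k.succ)) (Fin (N k.castSucc)) ℂ) :
    gramDet (channelProduct N Q) = 1 :=
  gramDet_isometry (U := (1 : Matrix (Fin (N 0)) (Fin (N 0)) ℂ)) (by simp)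

lemma channelProduct_succ (N : Fin (K + 2) → ℕ)
    (Q : ∀ k : Fin (K + 1), Matrix (Fin (N k.succ)) (Fin (N k.castSucc)) ℂ) :
    channelProduct N Q =
      Q (Fin.last K) * channelProduct (fun i => N i.castSucc) fun k => Q k.castSucc := by
  let P₀ : Matrix (Fin (N 0)) (Fin (N 0)) ℂ := 1
  have hpartial (i : Fin (K + 1)) :
      Fin.induction (motive := fun i => Matrix (Fin (N i)) (Fin (N 0)) ℂ)
        P₀ (fun k P => Q k * P) i.castSucc =
      Fin.induction (motive := fun i : Fin (K + 1) => Matrix (Fin (N i.castSucc)) (Fin (N 0)) ℂ)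
        P₀ (fun k P => Q k.castSucc * P) i := by
    induction i using Fin.induction with
    | zero => rfl
    | succ i ih =>
      exact congrArg (fun P : Matrix (Fin (N i.castSucc.castSucc)) _ ℂ => Q i.castSucc * P) ih
  exact congrArg (fun P : Matrix (Fin (N (Fin.last K).castSucc)) _ ℂ => Q (Fin.last K) * P)
    (hpartial (Fin.last K))

lemma continuous_channelProduct (N : Fin (K + 1) → ℕ) : Continuous (channelProduct N) := by
  induction K with
  | zero => exact continuous_const
  | succ K ih =>
    simp only [funext (channelProduct_succ N)]
    exact (continuous_apply _).matrix_mul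
      ((ih fun i => N i.castSucc).comp (by fun_prop))

lemma indepFun_last_channelProduct {Ω : Type*} [MeasurableSpace Ω] {μ : Measure Ω}
    (N : Fin (K + 2) → ℕ)
    {Q : ∀ k : Fin (K + 1), Ω → Matrix (Fin (N k.succ)) (Fin (N k.castSucc)) ℂ}
    (hQ : ∀ k, AEMeasurable (Q k) μ) (hQindep : iIndepFun Q μ) :
    IndepFun (Q (Fin.last K))
      (fun ω => channelProduct (fun i => N i.castSucc) fun k => Q k.castSucc ω) μ := by
  refine indepFun_of_dependsOn hQindep hQ (S := Finset.univ.erase (Fin.last K))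
    (φ := fun M => channelProduct (fun i => N i.castSucc) fun k => M k.castSucc)
    ((continuous_channelProduct _).comp (by fun_prop)).measurable (fun M M' hMM' => ?_)
    (Finset.notMem_erase _ _)
  have hinit (k : Fin K) : M k.castSucc = M' k.castSucc := hMM' _ (by simp [k.castSucc_ne_last])
  simp only [hinit]

lemma identDistrib_gramDet_channelProduct_succ {Ω Ω' : Type*} [MeasurableSpace Ω]
    [MeasurableSpace Ω'] {μ : Measure Ω} {ν : Measure Ω'} (N : Fin (K + 2) → ℕ)
    {Q : ∀ k : Fin (K + 1), Ω → Matrix (Fin (N k.succ)) (Fin (N k.castSucc)) ℂ}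
    (hQ : ∀ k, IsRayleighMIMO (Q k) μ) (hQindep : iIndepFun Q μ)
    {Q' : Ω' → Matrix (Fin (N (Fin.last K).succ)) (Fin (N 0)) ℂ} (hQ' : IsRayleighMIMO Q' ν) :
    IdentDistrib (fun ω => gramDet (channelProduct N fun k => Q k ω))
      (fun p : Ω' × Ω => gramDet (Q' p.1) *
        gramDet (channelProduct (fun i => N i.castSucc) fun k => Q k.castSucc p.2))
      μ (ν.prod μ) := by
  have hQ_meas (k) : AEMeasurable (Q k) μ := (hQ k).aemeasurable
  simp only [channelProduct_succ]
  exact (hQ (Fin.last K)).identDistrib_gramDet_mul_of_indepFun hQ'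
    ((continuous_channelProduct _).measurable.comp_aemeasurable
      (aemeasurable_pi_lambda _ fun k => hQ_meas k.castSucc))
    (indepFun_last_channelProduct N hQ_meas hQindep)

end ChannelProduct

theorem lemma1_general {Ω : Type*} [MeasurableSpace Ω] {K : ℕ} {Ω' : Fin K → Type*}
    [∀ k, MeasurableSpace (Ω' k)] (μ : Measure Ω) (ν : ∀ k, Measure (Ω' k))
    (N : Fin (K + 1) → ℕ) (hN : ∀ k, N 0 ≤ N k)
    (Q : ∀ k : Fin K, Ω → Matrix (Fin (N k.succ)) (Fin (N k.castSucc)) ℂ)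
    (hQ : ∀ k, IsRayleighMIMO (Q k) μ) (hQindep : iIndepFun Q μ)
    (Qhat : ∀ k : Fin K, Ω' k → Matrix (Fin (N k.succ)) (Fin (N 0)) ℂ)
    (hQhat : ∀ k, IsRayleighMIMO (Qhat k) (ν k)) :
    HasIntegrableLog (fun ω => gramDet (channelProduct N fun k => Q k ω)) μ ∧
    (∀ k, HasIntegrableLog (fun ω => gramDet (Qhat k ω)) (ν k)) ∧
    ∫ ω, Real.log (gramDet (channelProduct N fun k => Q k ω)) ∂μ =
      ∑ k, ∫ ω, Real.log (gramDet (Qhat k ω)) ∂ν k := by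
  have := hQindep.isProbabilityMeasure
  have hhat (k : Fin K) := (hQhat k).hasIntegrableLog_gramDet (hN k.succ)
  suffices h : HasIntegrableLog (fun ω => gramDet (channelProduct N fun k => Q k ω)) μ ∧
      ∫ ω, Real.log (gramDet (channelProduct N fun k => Q k ω)) ∂μ =
        ∑ k, ∫ ω, Real.log (gramDet (Qhat k ω)) ∂ν k from ⟨h.1, hhat, h.2⟩
  induction K with
  | zero =>
    simp only [gramDet_channelProduct_zero, Real.log_one, integral_zero, Finset.univ_eq_empty,
      Finset.sum_empty, and_true]
    exact ⟨.of_forall fun _ => one_pos, by simp⟩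
  | succ K ih =>
    have := (hQhat (Fin.last K)).isProbabilityMeasure
    obtain ⟨hH, hH_integral⟩ := ih (fun k => ν k.castSucc) (fun i => N i.castSucc)
      (fun k => hN k.castSucc) (fun k => Q k.castSucc) (fun k => hQ k.castSucc)
      (hQindep.precomp (Fin.castSucc_injective K)) (fun k => Qhat k.castSucc)
      (fun k => hQhat k.castSucc) (fun k => hhat k.castSucc)
    have hfactor := identDistrib_gramDet_channelProduct_succ N hQ hQindep (hQhat (Fin.last K))
    have hprod := (hhat (Fin.last K)).mul_prod hH
    refine ⟨hprod.of_identDistrib hfactor, ?_⟩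
    rw [(identDistrib_log hfactor).integral_eq, (hhat (Fin.last K)).integral_log_mul_prod hH,
      hH_integral, Fin.sum_univ_castSucc, add_comm]
    rfl

theorem lemma1 {Ω Ω' : Type*} [MeasurableSpace Ω] [MeasurableSpace Ω']
    (μ : Measure Ω) [IsProbabilityMeasure μ] (ν : Measure Ω') [IsProbabilityMeasure ν]
    (K : ℕ) (N : Fin (K + 1) → ℕ) (hN : ∀ k, N 0 ≤ N k)
    (Q : ∀ k : Fin K, Ω → Matrix (Fin (N k.succ)) (Fin (N k.castSucc)) ℂ)
    (hQ : ∀ k, IsRayleighMIMO (Q k) μ) (hQindep : iIndepFun Q μ)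
    (Qhat : ∀ k : Fin K, Ω' → Matrix (Fin (N k.succ)) (Fin (N 0)) ℂ)
    (hQhat : ∀ k, IsRayleighMIMO (Qhat k) ν) (hQhatindep : iIndepFun Qhat ν) :
    (∀ᵐ ω ∂μ, 0 < gramDet (channelProduct N fun k => Q k ω)) ∧
    (∀ k, ∀ᵐ ω ∂ν, 0 < gramDet (Qhat k ω)) ∧
    Integrable (fun ω => Real.log (gramDet (channelProduct N fun k => Q k ω))) μ ∧
    (∀ k, Integrable (fun ω => Real.log (gramDet (Qhat k ω))) ν) ∧
    ∫ ω, Real.log (gramDet (channelProduct N fun k => Q k ω)) ∂μ =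
      ∑ k : Fin K, ∫ ω, Real.log (gramDet (Qhat k ω)) ∂ν := by
  obtain ⟨hH, hhat, hsum⟩ := lemma1_general μ (fun _ => ν) N hN Q hQ hQindep Qhat hQhat
  exact ⟨hH.ae_pos, fun k => (hhat k).ae_pos, hH.integrable_log,
    fun k => (hhat k).integrable_log, hsum⟩
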